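/- A C*-category is a $\mathbb{C}$-linear category $\mathcal C$ (with identity morphisms), with morphism spaces written $(X,Y)$, such that every $(X,Y)$ is a complex Banach space, $\|b\circ a\|\le\|a\|\,\|b\|$ for $a\in(X,Y)$, $b\in(Y,Z)$, and there are conjugate linear maps $(X,Y)\to(Y,X)$, $a\mapsto a^*$, with $a^{**}=a$ and $(b\circ a)^*=a^*\circ b^*$, such that $\|h\|^2=\|h^*\circ h\|$ for every $h\in(X,Y)$, and for every $h\in(X,Y)$ there is $g\in(X,X)$ with $h^*\circ h=g^*\circ g$. Let $\mathcal C$ be a C*-category, and let $(X,Y)'$ and $(X,Y)''$ be the Banach space dual and bidual of $(X,Y)$. The Arens composition of $F\in(X,Y)''$ and $G\in(Y,Z)''$ is the element $G\circ F\in(X,Z)''$ given, for $f\in (X,Z)'$, $b\in(Y,Z)$ and $a\in(X,Y)$, by $$\langle G\circ F,f\rangle=\langle G,fF\rangle,\qquad \langle fF,b\rangle=\langle F,bf\rangle,\qquad \langle bf,a\rangle=\langle f,b\circ a\rangle .$$ The Arens bidual $\mathcal C''$ is the linear category with the same objects as $\mathcal C$, morphism spaces $(X,Y)''$ with the bidual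 norm, the Arens composition, and as identities the canonical images of the identities of $\mathcal C$. The extended involution $(X,Y)''\to(Y,X)''$, $F\mapsto F^*$, is given by $\langle F^*,f\rangle=\overline{\langle F,f^*\rangle}$ for $f\in(Y,X)'$, where $f^*\in(X,Y)'$ is $\langle f^*,a\rangle=\overline{\langle f,a^*\rangle}$ for $a\in (X,Y)$. Then: 1. $\mathcal C$ is Arens regular: for all objects $X,Y,Z$ the Arens composition $(X,Y)''\times(Y,Z)''\to(X,Z)''$, $(F,G)\mapsto G\circ F$, is separately weak*-continuous, i.e. weak*-continuous in $G$ for each fixed $F$ and in $F$ for each fixed $G$. 2. The Arens bidual $\mathcal C''$, with the bidual norms and the extended involution, is a C*-category. -/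

import Mathlib

open CategoryTheory

universe v u

/-- A normed `ℂ`-linear category: every morphism space is a complex normed space, composition is
bilinear, and the norm is submultiplicative. (Completeness of the morphism spaces is not part of
this definition.) Recall that `a ≫ b` is Mathlib's notation for the composite `b ∘ a`. -/
class NormedLinearCategory (C : Type u) [Category.{v} C] where
  homNormedAddCommGroup : ∀ X Y : C, NormedAddCommGroup (X ⟶ Y)
  homNormedSpace : ∀ X Y : C, NormedSpace ℂ (X ⟶ Y)
  add_comp : ∀ {X Y Z : C} (a a' : X ⟶ Y) (b : Y ⟶ Z), (a + a') ≫ b = a ≫ b + a' ≫ b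
  comp_add : ∀ {X Y Z : C} (a : X ⟶ Y) (b b' : Y ⟶ Z), a ≫ (b + b') = a ≫ b + a ≫ b'
  smul_comp : ∀ {X Y Z : C} (c : ℂ) (a : X ⟶ Y) (b : Y ⟶ Z), (c • a) ≫ b = c • (a ≫ b)
  comp_smul : ∀ {X Y Z : C} (a : X ⟶ Y) (c : ℂ) (b : Y ⟶ Z), a ≫ (c • b) = c • (a ≫ b)
  norm_comp_le : ∀ {X Y Z : C} (a : X ⟶ Y) (b : Y ⟶ Z), ‖a ≫ b‖ ≤ ‖a‖ * ‖b‖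

attribute [reducible, instance] NormedLinearCategory.homNormedAddCommGroup
attribute [reducible, instance] NormedLinearCategory.homNormedSpace

namespace NormedLinearCategory

variable {C : Type u} [Category.{v} C] [NormedLinearCategory C]

instance toPreadditive : Preadditive C where
  homGroup _ _ := inferInstance
  add_comp _ _ _ a a' b := NormedLinearCategory.add_comp a a' b
  comp_add _ _ _ a b b' := NormedLinearCategory.comp_add a b b'

instance toLinear : Linear ℂ C where
  homModule _ _ := inferInstance
  smul_comp _ _ _ c a b := NormedLinearCategory.smul_comp c a b
  comp_smul _ _ _ a c b := NormedLinearCategory.comp_smul a c b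

end NormedLinearCategory

/-- A C*-category: a `ℂ`-linear category (with identities) whose morphism spaces are Banach spaces
with submultiplicative norm, with a conjugate linear, involutive, contravariant `h ↦ h⋆`, satisfying
the C*-identity, and in which every `h⋆ ∘ h` is of the form `g⋆ ∘ g` with `g` an endomorphism. -/
class CStarCategory (C : Type u) [Category.{v} C] extends NormedLinearCategory C where
  complete : ∀ X Y : C, CompleteSpace (X ⟶ Y)
  adj : ∀ {X Y : C}, (X ⟶ Y) → (Y ⟶ X)
  adj_add : ∀ {X Y : C} (a b : X ⟶ Y), adj (a + b) = adj a + adj b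
  adj_smul : ∀ {X Y : C} (c : ℂ) (a : X ⟶ Y), adj (c • a) = (starRingEnd ℂ) c • adj a
  adj_adj : ∀ {X Y : C} (a : X ⟶ Y), adj (adj a) = a
  adj_comp : ∀ {X Y Z : C} (a : X ⟶ Y) (b : Y ⟶ Z), adj (a ≫ b) = adj b ≫ adj a
  norm_sq_eq : ∀ {X Y : C} (h : X ⟶ Y), ‖h‖ ^ 2 = ‖h ≫ adj h‖
  exists_adj_comp_self : ∀ {X Y : C} (h : X ⟶ Y), ∃ g : X ⟶ X, h ≫ adj h = g ≫ adj g

section Arens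

variable {C : Type u} [Category.{v} C] [NormedLinearCategory C]

/-- The dual space `(X,Y)'`. -/
abbrev HomDual (X Y : C) : Type v := StrongDual ℂ (X ⟶ Y)

/-- The bidual space `(X,Y)''`. -/
abbrev HomBidual (X Y : C) : Type v := StrongDual ℂ (HomDual X Y)

/-- Composition `a ↦ b ↦ b ∘ a` as a bounded bilinear map. -/
noncomputable def homCompL (X Y Z : C) : (X ⟶ Y) →L[ℂ] (Y ⟶ Z) →L[ℂ] (X ⟶ Z) :=
  LinearMap.mkContinuous₂
    (LinearMap.mk₂ ℂ (fun (a : X ⟶ Y) (b : Y ⟶ Z) => a ≫ b)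
      NormedLinearCategory.add_comp NormedLinearCategory.smul_comp
      NormedLinearCategory.comp_add (fun c a b => NormedLinearCategory.comp_smul a c b))
    1 (fun a b => by simpa using NormedLinearCategory.norm_comp_le a b)

/-- For `f ∈ (X,Z)'`, the bounded map `(Y,Z) → (X,Y)'`, `b ↦ bf`, where `⟨bf, a⟩ = ⟨f, b ∘ a⟩`. -/
noncomputable def arensLeft {X Z : C} (Y : C) (f : HomDual X Z) : (Y ⟶ Z) →L[ℂ] HomDual X Y :=
  (ContinuousLinearMap.compL ℂ (X ⟶ Y) (X ⟶ Z) ℂ f).comp (homCompL X Y Z).flip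

theorem arensLeft_apply {X Y Z : C} (f : HomDual X Z) (b : Y ⟶ Z) (a : X ⟶ Y) :
    arensLeft Y f b a = f (a ≫ b) := rfl

theorem norm_arensLeft_apply_le {X Y Z : C} (f : HomDual X Z) (b : Y ⟶ Z) :
    ‖arensLeft Y f b‖ ≤ ‖f‖ * ‖b‖ := by
  refine ContinuousLinearMap.opNorm_le_bound _ (by positivity) fun a => ?_
  rw [arensLeft_apply]
  calc ‖f (a ≫ b)‖ ≤ ‖f‖ * ‖a ≫ b‖ := f.le_opNorm _
    _ ≤ ‖f‖ * (‖a‖ * ‖b‖) := by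
      gcongr; exact NormedLinearCategory.norm_comp_le a b
    _ = ‖f‖ * ‖b‖ * ‖a‖ := by ring

/-- For `F ∈ (X,Y)''` and `f ∈ (X,Z)'`, the functional `fF ∈ (Y,Z)'`, `⟨fF, b⟩ = ⟨F, bf⟩`. -/
noncomputable def arensRight {X Y Z : C} (F : HomBidual X Y) (f : HomDual X Z) : HomDual Y Z :=
  F.comp (arensLeft Y f)

theorem arensRight_apply {X Y Z : C} (F : HomBidual X Y) (f : HomDual X Z) (b : Y ⟶ Z) :
    arensRight F f b = F (arensLeft Y f b) := rfl

theorem norm_arensRight_le {X Y Z : C} (F : HomBidual X Y) (f : HomDual X Z) :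
    ‖arensRight F f‖ ≤ ‖F‖ * ‖f‖ := by
  refine ContinuousLinearMap.opNorm_le_bound _ (by positivity) fun b => ?_
  rw [arensRight_apply]
  calc ‖F (arensLeft Y f b)‖ ≤ ‖F‖ * ‖arensLeft Y f b‖ := F.le_opNorm _
    _ ≤ ‖F‖ * (‖f‖ * ‖b‖) := by gcongr; exact norm_arensLeft_apply_le f b
    _ = ‖F‖ * ‖f‖ * ‖b‖ := by ring

/-- The Arens composite `G ∘ F ∈ (X,Z)''` of `F ∈ (X,Y)''` and `G ∈ (Y,Z)''`:
`⟨G ∘ F, f⟩ = ⟨G, fF⟩`. -/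
noncomputable def arensComp {X Y Z : C} (F : HomBidual X Y) (G : HomBidual Y Z) :
    HomBidual X Z :=
  LinearMap.mkContinuous
    { toFun := fun f => G (arensRight F f)
      map_add' := fun f g => by
        rw [← map_add]; congr 1; ext b
        exact map_add F (arensLeft Y f b) (arensLeft Y g b)
      map_smul' := fun c f => by
        rw [RingHom.id_apply, ← map_smul]; congr 1; ext b
        exact map_smul F c (arensLeft Y f b) }
    (‖F‖ * ‖G‖) (fun f => by
      calc ‖G (arensRight F f)‖ ≤ ‖G‖ * ‖arensRight F f‖ := G.le_opNorm _
        _ ≤ ‖G‖ * (‖F‖ * ‖f‖) := by gcongr; exact norm_arensRight_le F f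
        _ = ‖F‖ * ‖G‖ * ‖f‖ := by ring)

theorem arensComp_apply {X Y Z : C} (F : HomBidual X Y) (G : HomBidual Y Z) (f : HomDual X Z) :
    arensComp F G f = G (arensRight F f) := rfl

theorem norm_arensComp_le {X Y Z : C} (F : HomBidual X Y) (G : HomBidual Y Z) :
    ‖arensComp F G‖ ≤ ‖F‖ * ‖G‖ :=
  LinearMap.mkContinuous_norm_le _ (by positivity) _

/-- The category is Arens regular: the Arens composition `(F, G) ↦ G ∘ F` on the biduals is
weak*-continuous in `G` for fixed `F`, and in `F` for fixed `G`. -/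
def ArensRegular (C : Type u) [Category.{v} C] [NormedLinearCategory C] : Prop :=
  ∀ X Y Z : C,
    (∀ F : HomBidual X Y, Continuous fun G : WeakDual ℂ (HomDual Y Z) =>
      StrongDual.toWeakDual (arensComp F (WeakDual.toStrongDual G))) ∧
    (∀ G : HomBidual Y Z, Continuous fun F : WeakDual ℂ (HomDual X Y) =>
      StrongDual.toWeakDual (arensComp (WeakDual.toStrongDual F) G))

end Arens

/-- The Arens bidual of a normed linear category: it has the same objects. -/
structure ArensBidual (C : Type u) where
  /-- the underlying object of the original category -/
  obj : C

namespace ArensBidual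

variable {C : Type u} [Category.{v} C]

/-- The morphism spaces of the Arens bidual are the biduals `(X,Y)''`, the composition is the Arens
composition, and the identities are the canonical images of the identities. -/
noncomputable instance [NormedLinearCategory C] : Category.{v} (ArensBidual C) where
  Hom X Y := HomBidual X.obj Y.obj
  id X := NormedSpace.inclusionInDoubleDual ℂ (X.obj ⟶ X.obj) (𝟙 X.obj)
  comp F G := arensComp F G
  id_comp {X Y} F := by
    refine ContinuousLinearMap.ext fun f => ?_
    change F _ = F f
    congr 1; ext b
    change f (𝟙 X.obj ≫ b) = f b
    rw [Category.id_comp]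
  comp_id {X Y} F := by
    refine ContinuousLinearMap.ext fun f => ?_
    change F _ = F f
    congr 1; ext a
    change f (a ≫ 𝟙 Y.obj) = f a
    rw [Category.comp_id]
  assoc {W X Y Z} F G H := by
    refine ContinuousLinearMap.ext fun f => ?_
    change H _ = H _
    congr 1; ext c
    change G _ = G _
    congr 1; ext b
    change F _ = F _
    congr 1; ext a
    change f ((a ≫ b) ≫ c) = f (a ≫ b ≫ c)
    rw [Category.assoc]

/-- The morphism spaces of the Arens bidual carry the bidual norms. -/
noncomputable instance toNormedLinearCategory [NormedLinearCategory C] :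
    NormedLinearCategory (ArensBidual C) where
  homNormedAddCommGroup X Y := inferInstanceAs (NormedAddCommGroup (HomBidual X.obj Y.obj))
  homNormedSpace X Y := inferInstanceAs (NormedSpace ℂ (HomBidual X.obj Y.obj))
  add_comp {X Y Z} F F' G := by
    refine ContinuousLinearMap.ext fun f => ?_
    exact map_add (show HomBidual Y.obj Z.obj from G) (arensRight F f) (arensRight F' f)
  comp_add F G G' := rfl
  smul_comp {X Y Z} c F G := by
    refine ContinuousLinearMap.ext fun f => ?_
    exact map_smul (show HomBidual Y.obj Z.obj from G) c (arensRight F f)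
  comp_smul F c G := rfl
  norm_comp_le F G := norm_arensComp_le F G

end ArensBidual

section Involution

variable {C : Type u} [Category.{v} C] [CStarCategory C]

theorem norm_adj_le {X Y : C} (a : X ⟶ Y) : ‖CStarCategory.adj a‖ ≤ ‖a‖ := by
  have h := CStarCategory.norm_sq_eq (CStarCategory.adj a)
  rw [CStarCategory.adj_adj] at h
  have h' := NormedLinearCategory.norm_comp_le (CStarCategory.adj a) a
  by_contra! hlt
  have h0 := norm_nonneg a
  nlinarith

/-- For `f ∈ (Y,X)'`, the functional `f⋆ ∈ (X,Y)'`, where `⟨f⋆, a⟩` is the complex conjugate of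
`⟨f, a⋆⟩`. -/
noncomputable def dualAdj {X Y : C} (f : HomDual Y X) : HomDual X Y :=
  LinearMap.mkContinuous
    { toFun := fun a => (starRingEnd ℂ) (f (CStarCategory.adj a))
      map_add' := fun a b => by rw [CStarCategory.adj_add, map_add, map_add]
      map_smul' := fun c a => by
        rw [CStarCategory.adj_smul, map_smul]; simp }
    ‖f‖ (fun a => by
      calc ‖(starRingEnd ℂ) (f (CStarCategory.adj a))‖ = ‖f (CStarCategory.adj a)‖ :=
            RCLike.norm_conj _
        _ ≤ ‖f‖ * ‖CStarCategory.adj a‖ := f.le_opNorm _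
        _ ≤ ‖f‖ * ‖a‖ := by gcongr; exact norm_adj_le a)

theorem dualAdj_apply {X Y : C} (f : HomDual Y X) (a : X ⟶ Y) :
    dualAdj f a = (starRingEnd ℂ) (f (CStarCategory.adj a)) := rfl

theorem norm_dualAdj_le {X Y : C} (f : HomDual Y X) : ‖dualAdj f‖ ≤ ‖f‖ :=
  LinearMap.mkContinuous_norm_le _ (norm_nonneg f) _

/-- The extended involution: for `F ∈ (X,Y)''`, the element `F⋆ ∈ (Y,X)''`, where `⟨F⋆, f⟩` is the
complex conjugate of `⟨F, f⋆⟩`. -/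
noncomputable def bidualAdj {X Y : C} (F : HomBidual X Y) : HomBidual Y X :=
  LinearMap.mkContinuous
    { toFun := fun f => (starRingEnd ℂ) (F (dualAdj f))
      map_add' := fun f g => by
        rw [← map_add, ← map_add]; congr 2; ext a
        exact map_add (starRingEnd ℂ) _ _
      map_smul' := fun c f => by
        have h : dualAdj (c • f) = (starRingEnd ℂ) c • dualAdj f := by
          ext a; exact map_mul (starRingEnd ℂ) _ _
        rw [h, map_smul]; simp }
    ‖F‖ (fun f => by
      calc ‖(starRingEnd ℂ) (F (dualAdj f))‖ = ‖F (dualAdj f)‖ := RCLike.norm_conj _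
        _ ≤ ‖F‖ * ‖dualAdj f‖ := F.le_opNorm _
        _ ≤ ‖F‖ * ‖f‖ := by gcongr; exact norm_dualAdj_le f)

theorem bidualAdj_apply {X Y : C} (F : HomBidual X Y) (f : HomDual Y X) :
    bidualAdj F f = (starRingEnd ℂ) (F (dualAdj f)) := rfl

/-- The extended involution on the morphisms of the Arens bidual. -/
noncomputable def ArensBidual.adj {X Y : ArensBidual C} (F : X ⟶ Y) : Y ⟶ X :=
  bidualAdj (X := X.obj) (Y := Y.obj) F

end Involution

/-! Everything rests on domination: each `f` in `(X,Y)'` admits a positive functional `φ` on `(X,X)`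
with `‖φ‖ ≤ ‖f‖²` and `|f(c)|² ≤ φ(c⋆c)` (`exists_isPositiveFunctional`, a Hahn–Banach argument).
The GNS map `T` of `φ` sends `(X,Y)` to a Hilbert space `H`, and `f` factors through `T`. Since `H`
is reflexive, each `F` in `(X,Y)''` acts on such functionals as a vector `ξ` of `H`.

Regularity: `|f(b∘a)| ≤ ‖b‖ ‖T a‖` when `φ` dominates `f` in `(X,Z)'`, so `b ↦ bf` factors through
the dual of `H`, and `F ↦ G(fF)` is evaluation at an element of `(X,Y)'`. Hence also the involution
reverses Arens composites. C*-identity: `⟨F⋆∘F, φ⟩ = ‖ξ‖²` bounds `|F(f)|²`. Positivity: if `n` is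
the negative part of `F⋆∘F`, then `(F∘n)⋆∘(F∘n) = -n³`. Dominating functionals are nonnegative on
the left and on `n³`, which forces `n = 0`. -/

open scoped InnerProductSpace

/-! ### Domination of functionals on pre-Hilbert modules. -/

section Domination

variable {A V : Type*} [CStarAlgebra A] [PartialOrder A] [StarOrderedRing A]
  [NormedAddCommGroup V] [NormedSpace ℂ V]

/-- The cone of pairs `(h, t)` for which some `c` with `f c = t` satisfies
`⟨c, d⟩ + ⟨d, c⟩ ≤ h + t ⟨d, d⟩` for all `d`. -/
def dominationCone (B : V →ₗ⋆[ℂ] V →ₗ[ℂ] A) (f : StrongDual ℂ V) : PointedCone ℝ (A × ℝ) where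
  carrier := {p | ∃ c, f c = p.2 ∧ ∀ d, B c d + B d c ≤ p.1 + p.2 • B d d}
  zero_mem' := ⟨0, by simp, by simp⟩
  add_mem' := by
    rintro p q ⟨c, hc, hc'⟩ ⟨e, he, he'⟩
    refine ⟨c + e, by simp [hc, he], fun d => ?_⟩
    have h := add_le_add (hc' d) (he' d)
    simp only [map_add, LinearMap.add_apply, Prod.fst_add, Prod.snd_add, add_smul]
    convert h using 1 <;> abel
  smul_mem' := by
    rintro ⟨r, hr⟩ p ⟨c, hc, hc'⟩
    refine ⟨(r : ℂ) • c, ?_, fun d => ?_⟩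
    · change f ((r : ℂ) • c) = ((r • p.2 : ℝ) : ℂ)
      simp [hc]
    · have h := smul_le_smul_of_nonneg_left (hc' d) hr
      change B ((r : ℂ) • c) d + B d ((r : ℂ) • c) ≤ r • p.1 + (r • p.2) • B d d
      rw [map_smulₛₗ, LinearMap.smul_apply, map_smul, Complex.conj_ofReal, Complex.coe_smul,
        Complex.coe_smul, ← smul_add, smul_assoc, ← smul_add]
      exact h

variable {B : V →ₗ⋆[ℂ] V →ₗ[ℂ] A}

/-- For `t > 0` the cone condition gives `⟨c, c⟩ ≤ t h`; testing against all `d` is a linearised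
form of this that is visibly additive. With `apply_self_mem_dominationCone` the bound contains `∑
|f(cᵢ)|² ≤ ‖f‖² ‖∑ ⟨cᵢ, cᵢ⟩‖`, the estimate Hahn–Banach needs. -/
theorem snd_le_of_mem_dominationCone (hnn : ∀ x, 0 ≤ B x x)
    (hnorm : ∀ x, ‖B x x‖ = ‖x‖ ^ 2) (f : StrongDual ℂ V) {p : A × ℝ}
    (hp : p ∈ dominationCone B f) : p.2 ≤ ‖f‖ ^ 2 * ‖p.1‖ := by
  obtain ⟨h, t⟩ := p
  obtain ⟨c, hc, hc'⟩ := hp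
  simp only at hc hc' ⊢
  rcases le_or_gt t 0 with ht | ht
  · exact ht.trans (by positivity)
  -- The choice `d = c / t` yields `2⟨c, c⟩/t ≤ h + ⟨c, c⟩/t`.
  have h1 := hc' (((t⁻¹ : ℝ) : ℂ) • c)
  have h2 : B c c ≤ t • h := by
    have h3 := smul_le_smul_of_nonneg_left h1 ht.le
    have e1 : B c (((t⁻¹ : ℝ) : ℂ) • c) = t⁻¹ • B c c := by rw [map_smul, Complex.coe_smul]
    have e2 : ∀ d, B (((t⁻¹ : ℝ) : ℂ) • c) d = t⁻¹ • B c d := fun d => by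
      rw [map_smulₛₗ, LinearMap.smul_apply, Complex.conj_ofReal, Complex.coe_smul]
    rw [e2, e2, e1, smul_add, smul_add, smul_inv_smul₀ ht.ne', smul_inv_smul₀ ht.ne',
      smul_inv_smul₀ ht.ne'] at h3
    exact le_of_add_le_add_right h3
  have h5 := CStarAlgebra.norm_le_norm_of_nonneg_of_le (hnn c) h2
  rw [hnorm, norm_smul, Real.norm_of_nonneg ht.le] at h5
  have h6 : t ≤ ‖f‖ * ‖c‖ := by
    have := f.le_opNorm c
    rwa [hc, Complex.norm_real, Real.norm_of_nonneg ht.le] at this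
  have h7 : t ^ 2 ≤ ‖f‖ ^ 2 * (t * ‖h‖) := by
    calc t ^ 2 ≤ (‖f‖ * ‖c‖) ^ 2 := by gcongr
      _ = ‖f‖ ^ 2 * ‖c‖ ^ 2 := by ring
      _ ≤ _ := by gcongr
  refine le_of_mul_le_mul_left ?_ ht
  linarith [h7]

theorem mem_dominationCone_of_nonneg (f : StrongDual ℂ V) {h : A}
    (hh : 0 ≤ h) : (h, (0 : ℝ)) ∈ dominationCone B f :=
  ⟨0, by simp, by simpa using hh⟩

theorem apply_self_mem_dominationCone (hnn : ∀ x, 0 ≤ B x x) (f : StrongDual ℂ V) (c : V) :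
    (B c c, ‖f c‖ ^ 2) ∈ dominationCone B f := by
  -- The required inequality is the expansion of `0 ≤ ⟨c - f(c) d, c - f(c) d⟩`.
  refine ⟨(starRingEnd ℂ) (f c) • c, ?_, fun d => ?_⟩
  · simp [Complex.conj_mul']
  · have h := hnn (c - f c • d)
    have h1 : ((‖f c‖ ^ 2 : ℝ)) • B d d = (starRingEnd ℂ (f c) * f c) • B d d := by
      rw [Complex.conj_mul', ← Complex.coe_smul]; simp
    rw [← sub_nonneg]
    convert h using 1
    simp only [h1, map_smulₛₗ, LinearMap.smul_apply, RingHom.id_apply, map_sub,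
      LinearMap.sub_apply, Complex.conj_conj, mul_smul]
    module

/-- A bounded functional on a pre-Hilbert module is dominated by a bounded real functional on the
C*-algebra. -/
theorem exists_real_dominating (hnn : ∀ x, 0 ≤ B x x)
    (hnorm : ∀ x, ‖B x x‖ = ‖x‖ ^ 2) (f : StrongDual ℂ V) :
    ∃ φ : StrongDual ℝ A, ‖φ‖ ≤ ‖f‖ ^ 2 ∧ (∀ h, 0 ≤ h → 0 ≤ φ h) ∧
      ∀ c, ‖f c‖ ^ 2 ≤ φ (B c c) := by
  let K : ℝ := ‖f‖ ^ 2
  -- A functional `g(h, t) = t - φ(h)` nonnegative on `s` encodes both demands on `φ`: `s` contains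
  -- every `(h, K‖h‖)`, and `-p` for every `p` in the domination cone.
  let s : PointedCone ℝ (A × ℝ) :=
    { carrier := {p | ∃ q ∈ dominationCone B f, K * ‖p.1 + q.1‖ ≤ p.2 + q.2}
      zero_mem' := ⟨0, zero_mem _, by simp⟩
      add_mem' := by
        rintro p p' ⟨q, hq, h⟩ ⟨q', hq', h'⟩
        refine ⟨q + q', add_mem hq hq', ?_⟩
        have hK : 0 ≤ K := by positivity
        have := norm_add_le (p.1 + q.1) (p'.1 + q'.1)
        calc K * ‖(p + p').1 + (q + q').1‖ = K * ‖(p.1 + q.1) + (p'.1 + q'.1)‖ := by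
              congr 2; simp; abel
          _ ≤ K * (‖p.1 + q.1‖ + ‖p'.1 + q'.1‖) := by gcongr
          _ ≤ _ := by simp; linarith
      smul_mem' := by
        rintro r p ⟨q, hq, h⟩
        refine ⟨r • q, Submodule.smul_mem _ r hq, ?_⟩
        have hr : (0 : ℝ) ≤ r := r.2
        change K * ‖(r : ℝ) • p.1 + (r : ℝ) • q.1‖ ≤ (r : ℝ) * p.2 + (r : ℝ) * q.2
        rw [← smul_add, norm_smul, Real.norm_of_nonneg hr]
        nlinarith [mul_le_mul_of_nonneg_left h hr] }
  let F : (A × ℝ) →ₗ.[ℝ] ℝ :=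
    { domain := LinearMap.range (LinearMap.inr ℝ A ℝ)
      toFun := LinearMap.snd ℝ A ℝ ∘ₗ Submodule.subtype _ }
  obtain ⟨g, hgF, hgs⟩ := riesz_extension s F
    (by
      rintro ⟨x, t, rfl⟩ ⟨q, hq, h⟩
      change 0 ≤ t
      have h1 := snd_le_of_mem_dominationCone hnn hnorm f hq
      have h2 : K * ‖q.1‖ ≤ t + q.2 := by simpa using h
      linarith)
    (by
      intro y
      refine ⟨⟨(0, K * ‖y.1‖ - y.2), ⟨_, rfl⟩⟩, 0, zero_mem _, ?_⟩
      simp)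
  have hg2 : ∀ t : ℝ, g (0, t) = t := fun t => hgF ⟨(0, t), ⟨t, rfl⟩⟩
  have hg : ∀ h t, g (h, t) = g (h, 0) + t := fun h t => by
    nth_rw 2 [← hg2 t]
    rw [← map_add]; simp
  let φ₀ : A →ₗ[ℝ] ℝ := -(g ∘ₗ LinearMap.inl ℝ A ℝ)
  have hφ₀ : ∀ h, φ₀ h = -g (h, 0) := fun h => rfl
  have hle : ∀ h, φ₀ h ≤ K * ‖h‖ := fun h => by
    have := hgs (h, K * ‖h‖) ⟨0, zero_mem _, by simp⟩
    rw [hg] at this; rw [hφ₀]; linarith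
  have hP : ∀ p ∈ dominationCone B f, p.2 ≤ φ₀ p.1 := fun p hp => by
    have := hgs (-p) ⟨p, hp, by simp⟩
    rw [map_neg, ← Prod.mk.eta (p := p), hg] at this; rw [hφ₀]; linarith
  have habs : ∀ h, ‖φ₀ h‖ ≤ K * ‖h‖ := fun h => abs_le.2 ⟨by
    have := hle (-h)
    rw [map_neg, norm_neg] at this; linarith, hle h⟩
  refine ⟨φ₀.mkContinuous K habs, LinearMap.mkContinuous_norm_le _ (by positivity) _,
    fun h hh => ?_, fun c => ?_⟩
  · exact hP _ (mem_dominationCone_of_nonneg f hh)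
  · exact hP _ (apply_self_mem_dominationCone hnn f c)

/-- A bounded functional on a pre-Hilbert module is dominated by a positive functional on the
C*-algebra. -/
theorem exists_positive_dominating (hnn : ∀ x, 0 ≤ B x x)
    (hnorm : ∀ x, ‖B x x‖ = ‖x‖ ^ 2) (f : StrongDual ℂ V) :
    ∃ φ : StrongDual ℂ A, ‖φ‖ ≤ ‖f‖ ^ 2 ∧ (∀ h, φ (star h) = (starRingEnd ℂ) (φ h)) ∧
      (∀ h, 0 ≤ h → 0 ≤ (φ h).re) ∧ ∀ c, ‖f c‖ ^ 2 ≤ (φ (B c c)).re := by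
  obtain ⟨φ, hnφ, hpos, hdom⟩ := exists_real_dominating hnn hnorm f
  -- Averaging over the involution makes the complex extension hermitian and changes nothing on
  -- self-adjoint elements.
  let ψ : StrongDual ℝ A :=
    (1 / 2 : ℝ) • (φ + φ.comp (starL' ℝ : A ≃L[ℝ] A).toContinuousLinearMap)
  have hψ : ∀ h, ψ h = (1 / 2) * (φ h + φ (star h)) := fun h => rfl
  have hψs : ∀ h, ψ (star h) = ψ h := fun h => by rw [hψ, hψ, star_star, add_comm]
  have hsa : ∀ h, 0 ≤ h → ψ h = φ h := fun h hh => by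
    rw [hψ, (LE.le.isSelfAdjoint hh).star_eq]; ring
  have hre : ∀ h, (ψ.extendRCLike (𝕜 := ℂ) h).re = ψ h := fun h => by
    simp [StrongDual.extendRCLike_apply]
  refine ⟨ψ.extendRCLike, ?_, fun h => ?_, fun h hh => ?_, fun c => ?_⟩
  · rw [StrongDual.norm_extendRCLike]
    refine ContinuousLinearMap.opNorm_le_bound _ (by positivity) fun h => ?_
    have h1 := φ.le_of_opNorm_le hnφ h
    have h2 := φ.le_of_opNorm_le hnφ (star h)
    rw [norm_star] at h2
    rw [hψ, norm_mul, Real.norm_of_nonneg (by norm_num)]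
    linarith [norm_add_le (φ h) (φ (star h))]
  · have h1 : ψ (Complex.I • star h) = -ψ (Complex.I • h) := by
      rw [← hψs (Complex.I • star h), star_smul, star_star, ← map_neg]
      simp
    simp [StrongDual.extendRCLike_apply, hψs, h1]
  · rw [hre, hsa h hh]; exact hpos h hh
  · rw [hre, hsa _ (hnn c)]; exact hdom c

end Domination

/-! ### Hilbert spaces from positive semidefinite forms. -/

section GNS

variable {V : Type v} [NormedAddCommGroup V] [NormedSpace ℂ V]

/-- A positive semidefinite sesquilinear form is the pullback of the inner product of a
Hilbert space under a linear map with dense range. -/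
theorem exists_linearMap_hilbert_of_posSemidef {W : Type v} [AddCommGroup W] [Module ℂ W]
    (S : W →ₗ⋆[ℂ] W →ₗ[ℂ] ℂ)
    (hsymm : ∀ x y, (starRingEnd ℂ) (S y x) = S x y) (hnn : ∀ x, 0 ≤ (S x x).re) :
    ∃ (H : Type v) (_ : NormedAddCommGroup H) (_ : InnerProductSpace ℂ H) (_ : CompleteSpace H)
      (T : W →ₗ[ℂ] H), DenseRange T ∧ ∀ a b, ⟪T a, T b⟫_ℂ = S a b := by
  let core : PreInnerProductSpace.Core ℂ W :=
    { inner := fun a b => S a b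
      conj_inner_symm := hsymm
      re_inner_nonneg := hnn
      add_left := fun x y z => by rw [map_add]; rfl
      smul_left := fun x y r => by rw [map_smulₛₗ]; rfl }
  let _ : SeminormedAddCommGroup W := InnerProductSpace.Core.toSeminormedAddCommGroup (c := core)
  let _ : InnerProductSpace ℂ W := InnerProductSpace.ofCore core
  exact ⟨UniformSpace.Completion W, inferInstance, inferInstance, inferInstance,
    (UniformSpace.Completion.toComplL (𝕜 := ℂ) (E := W)).toLinearMap,
    UniformSpace.Completion.denseRange_coe, UniformSpace.Completion.inner_coe⟩

/-- A bounded positive semidefinite sesquilinear form is the pullback of the inner product of a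
Hilbert space under a bounded map with dense range. -/
theorem exists_hilbert_of_posSemidef (S : V →ₗ⋆[ℂ] V →ₗ[ℂ] ℂ)
    (hsymm : ∀ x y, (starRingEnd ℂ) (S y x) = S x y) (hnn : ∀ x, 0 ≤ (S x x).re)
    (M : ℝ) (hM : ∀ x, (S x x).re ≤ M * ‖x‖ ^ 2) :
    ∃ (H : Type v) (_ : NormedAddCommGroup H) (_ : InnerProductSpace ℂ H) (_ : CompleteSpace H)
      (T : V →L[ℂ] H), DenseRange T ∧ ∀ a b, ⟪T a, T b⟫_ℂ = S a b := by
  obtain ⟨H, i1, i2, i3, T, hT, hTS⟩ := exists_linearMap_hilbert_of_posSemidef S hsymm hnn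
  refine ⟨H, i1, i2, i3, T.mkContinuous (√(max M 0)) fun a => ?_, hT, hTS⟩
  have h1 : ‖T a‖ ^ 2 ≤ max M 0 * ‖a‖ ^ 2 := by
    rw [@norm_sq_eq_re_inner ℂ, hTS]
    exact (hM a).trans (by gcongr; exact le_max_left _ _)
  rw [← Real.sqrt_sq (norm_nonneg a), ← Real.sqrt_mul (le_max_right _ _)]
  exact Real.le_sqrt_of_sq_le h1

end GNS

/-! ### Factorisation through Hilbert spaces and reflexivity. -/

section Hilbert

/-- A functional dominated by `‖T ·‖` factors through `T`. -/
theorem exists_dual_extension {V H : Type*} [NormedAddCommGroup V] [NormedSpace ℂ V]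
    [NormedAddCommGroup H] [InnerProductSpace ℂ H] {T : V →L[ℂ] H} (hT : DenseRange T) (f : StrongDual ℂ V) {c : ℝ}
    (hc : 0 ≤ c) (hf : ∀ a, ‖f a‖ ≤ c * ‖T a‖) :
    ∃ ℓ : StrongDual ℂ H, ‖ℓ‖ ≤ c ∧ ℓ.comp T = f := by
  refine ⟨(f : V →ₗ[ℂ] ℂ).extendOfNorm (T : V →ₗ[ℂ] H), ?_, ?_⟩
  · exact ContinuousLinearMap.opNorm_le_bound _ hc
      (LinearMap.norm_extendOfNorm_apply_le hT c hf)
  · ext a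
    exact LinearMap.extendOfNorm_eq hT ⟨c, hf⟩ a

variable {V H : Type*} [NormedAddCommGroup V] [NormedSpace ℂ V] [NormedAddCommGroup H]
  [InnerProductSpace ℂ H] [CompleteSpace H]

/-- The value at `F` of the second transpose of `T : V → H`, with `H''` identified with `H`. -/
theorem exists_bidual_vector (T : V →L[ℂ] H) (F : StrongDual ℂ (StrongDual ℂ V)) :
    ∃ ξ : H, ∀ ℓ : StrongDual ℂ H, F (ℓ.comp T) = ℓ ξ := by
  let g : H →ₗ[ℂ] ℂ :=
    { toFun := fun η => (starRingEnd ℂ) (F ((InnerProductSpace.toDual ℂ H η).comp T))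
      map_add' := fun x y => by
        rw [map_add, ContinuousLinearMap.add_comp, map_add, map_add]
      map_smul' := fun c x => by
        rw [map_smulₛₗ, ContinuousLinearMap.smul_comp, map_smul]; simp }
  let G : StrongDual ℂ H := g.mkContinuous (‖F‖ * ‖T‖) fun η => by
    change ‖(starRingEnd ℂ) (F ((InnerProductSpace.toDual ℂ H η).comp T))‖ ≤ _
    rw [RCLike.norm_conj]
    refine (F.le_opNorm _).trans ?_
    rw [mul_assoc]
    gcongr
    refine (ContinuousLinearMap.opNorm_comp_le _ _).trans ?_
    rw [LinearIsometryEquiv.norm_map, mul_comm]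
  refine ⟨(InnerProductSpace.toDual ℂ H).symm G, fun ℓ => ?_⟩
  obtain ⟨η, rfl⟩ := (InnerProductSpace.toDual ℂ H).surjective ℓ
  rw [InnerProductSpace.toDual_apply_apply, ← inner_conj_symm,
    InnerProductSpace.toDual_symm_apply]
  exact (Complex.conj_conj _).symm

/-- A bounded map into a dual space that factors through the dual of a Hilbert space has weak*
continuous second transpose. -/
theorem exists_dual_forall_apply_comp_eq {W : Type*} [NormedAddCommGroup W] [NormedSpace ℂ W] {T : V →L[ℂ] H}
    (hT : DenseRange T) (m : W →L[ℂ] StrongDual ℂ V) {K : ℝ} (hK : 0 ≤ K)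
    (hm : ∀ b a, ‖m b a‖ ≤ K * ‖b‖ * ‖T a‖) (G : StrongDual ℂ (StrongDual ℂ W)) :
    ∃ g : StrongDual ℂ V, ∀ F : StrongDual ℂ (StrongDual ℂ V), G (F.comp m) = F g := by
  have hex : ∀ b, ∃ ℓ : StrongDual ℂ H, ‖ℓ‖ ≤ K * ‖b‖ ∧ ℓ.comp T = m b := fun b =>
    exists_dual_extension hT (m b) (by positivity) (hm b)
  choose L hLn hL using hex
  have hinj : ∀ ℓ ℓ' : StrongDual ℂ H, ℓ.comp T = ℓ'.comp T → ℓ = ℓ' := fun ℓ ℓ' h => by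
    refine DFunLike.coe_injective (hT.equalizer ℓ.continuous ℓ'.continuous ?_)
    exact congrArg DFunLike.coe h
  let L' : W →L[ℂ] StrongDual ℂ H := LinearMap.mkContinuous
    { toFun := L
      map_add' := fun b b' => hinj _ _ (by
        rw [hL, map_add, ContinuousLinearMap.add_comp, hL, hL])
      map_smul' := fun c b => hinj _ _ (by
        rw [hL, map_smul, RingHom.id_apply, ContinuousLinearMap.smul_comp, hL]) } K hLn
  let ev : H →L[ℂ] StrongDual ℂ W :=
    (ContinuousLinearMap.compL ℂ W (StrongDual ℂ H) ℂ).flip L' ∘L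
      NormedSpace.inclusionInDoubleDual ℂ H
  have hev : ∀ ξ b, ev ξ b = L b ξ := fun ξ b => rfl
  -- If `ξ` represents `F`, then `F ∘ m = ev ξ`, so `G(F ∘ m)` is the functional `G ∘ ev` of `H` at
  -- `ξ`, that is, `F` at its pullback along `T`.
  refine ⟨(G.comp ev).comp T, fun F => ?_⟩
  obtain ⟨ξ, hξ⟩ := exists_bidual_vector T F
  rw [hξ]
  change _ = G (ev ξ)
  congr 1
  ext b
  rw [hev, ← hξ, hL]; rfl

end Hilbert

/-! ### Jordan decomposition and endomorphism C*-algebras. -/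

/-- A self-adjoint element of a C*-algebra is of the form `p⋆ p - n` with `n = s⋆ s` and
`n h n = - (s n)⋆ (s n)`; moreover `n = 0` as soon as `s n = 0`. -/
theorem IsSelfAdjoint.exists_jordan {A : Type*} [CStarAlgebra A] {h : A} (hh : IsSelfAdjoint h) :
    ∃ p n s : A, star n = n ∧ h = star p * p - n ∧ n * h * n = -(star (s * n) * (s * n)) ∧
      (s * n = 0 → n = 0) := by
  let _ := CStarAlgebra.spectralOrder A
  have _ := CStarAlgebra.spectralOrderedRing A
  have hn := CFC.negPart_nonneg h
  have hp := CFC.posPart_nonneg h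
  have hns := (LE.le.isSelfAdjoint hn).star_eq
  have hs := CFC.sqrt_mul_sqrt_self (h⁻) hn
  have hq := CFC.sqrt_mul_sqrt_self (h⁺) hp
  have hss := (LE.le.isSelfAdjoint (CFC.sqrt_nonneg (h⁻))).star_eq
  have hqs := (LE.le.isSelfAdjoint (CFC.sqrt_nonneg (h⁺))).star_eq
  have hd := CFC.posPart_sub_negPart h hh
  have hz := CFC.posPart_mul_negPart h
  refine ⟨CFC.sqrt (h⁺), h⁻, CFC.sqrt (h⁻), hns, ?_, ?_, fun h0 => ?_⟩
  · rw [hqs, hq, hd]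
  · have h1 : h * h⁻ = -(h⁻ * h⁻) := by
      nth_rw 1 [← hd]
      rw [sub_mul, hz, zero_sub]
    have h2 : star (CFC.sqrt (h⁻) * h⁻) * (CFC.sqrt (h⁻) * h⁻) = h⁻ * (h⁻ * h⁻) := by
      rw [star_mul, hns, hss, mul_assoc, ← mul_assoc (CFC.sqrt (h⁻)), hs]
    rw [h2, mul_assoc, h1, mul_neg]
  · have h2 : h⁻ * h⁻ = 0 := by
      calc h⁻ * h⁻ = CFC.sqrt (h⁻) * (CFC.sqrt (h⁻) * h⁻) := by rw [← mul_assoc, hs]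
        _ = 0 := by rw [h0, mul_zero]
    rw [← CStarRing.star_mul_self_eq_zero_iff, hns, h2]

section EndAlgebra

variable {C : Type u} [Category.{v} C] [NormedLinearCategory C]

/-- The endomorphisms of an object form a C*-algebra as soon as they carry an involution with the
C*-identity. -/
@[reducible]
noncomputable def endCStarAlgebra (X : C) (hc : CompleteSpace (X ⟶ X)) (st : (X ⟶ X) → (X ⟶ X))
    (st_st : ∀ a, st (st a) = a) (st_add : ∀ a b, st (a + b) = st a + st b)
    (st_smul : ∀ (c : ℂ) a, st (c • a) = (starRingEnd ℂ) c • st a)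
    (st_comp : ∀ a b, st (a ≫ b) = st b ≫ st a)
    (norm_sq : ∀ a, ‖a‖ ^ 2 = ‖a ≫ st a‖) : CStarAlgebra (End X) where
  __ := NormedLinearCategory.homNormedAddCommGroup X X
  __ := NormedLinearCategory.homNormedSpace X X
  __ := (inferInstance : Ring (End X))
  __ := (inferInstance : Algebra ℂ (End X))
  __ := hc
  dist_eq := (NormedLinearCategory.homNormedAddCommGroup X X).dist_eq
  norm_mul_le a b := (NormedLinearCategory.norm_comp_le (X := X) (Y := X) (Z := X) b a).trans
    (mul_comm _ _).le
  star := st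
  star_involutive := st_st
  star_mul a b := st_comp b a
  star_add := st_add
  norm_mul_self_le a := by
    rw [← sq]
    exact (norm_sq a).le
  norm_smul_le := norm_smul_le (α := ℂ) (β := X ⟶ X)
  star_smul := st_smul

end EndAlgebra

/-! ### Positive functionals on a C*-category and their GNS maps. -/

section PositiveFunctionals

variable {C : Type u} [Category.{v} C] [CStarCategory C]

open CStarCategory (adj adj_add adj_smul adj_adj adj_comp norm_sq_eq exists_adj_comp_self)

noncomputable instance (X : C) : CStarAlgebra (End X) :=
  endCStarAlgebra X (CStarCategory.complete X X) adj adj_adj adj_add adj_smul adj_comp norm_sq_eq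

noncomputable instance (X : C) : PartialOrder (End X) := CStarAlgebra.spectralOrder (End X)

instance (X : C) : StarOrderedRing (End X) := CStarAlgebra.spectralOrderedRing (End X)

/-- The `End X`-valued inner product `⟨a, b⟩ = a⋆ ∘ b` on `(X, Y)`. -/
noncomputable def homInner (X Y : C) : (X ⟶ Y) →ₗ⋆[ℂ] (X ⟶ Y) →ₗ[ℂ] End X :=
  LinearMap.mk₂'ₛₗ (starRingEnd ℂ) (RingHom.id ℂ) (fun a b => b ≫ adj a)
    (fun a a' b => by rw [adj_add]; exact NormedLinearCategory.comp_add _ _ _)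
    (fun c a b => by rw [adj_smul]; exact NormedLinearCategory.comp_smul _ _ _)
    (fun a b b' => NormedLinearCategory.add_comp _ _ _)
    (fun c a b => NormedLinearCategory.smul_comp _ _ _)

theorem homInner_apply {X Y : C} (a b : X ⟶ Y) : homInner X Y a b = b ≫ adj a := rfl

theorem homInner_self_nonneg {X Y : C} (a : X ⟶ Y) : 0 ≤ homInner X Y a a := by
  obtain ⟨g, hg⟩ := exists_adj_comp_self a
  rw [homInner_apply, hg]
  exact star_mul_self_nonneg (R := End X) g

theorem norm_homInner_self {X Y : C} (a : X ⟶ Y) : ‖homInner X Y a a‖ = ‖a‖ ^ 2 :=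
  (norm_sq_eq a).symm

/-- Positive functionals on the endomorphisms of `X`. -/
structure IsPositiveFunctional {X : C} (φ : HomDual X X) : Prop where
  apply_adj : ∀ h : X ⟶ X, φ (adj h) = (starRingEnd ℂ) (φ h)
  re_nonneg : ∀ {Y : C} (a : X ⟶ Y), 0 ≤ (φ (a ≫ adj a)).re

/-- Every functional on `(X, Y)` is dominated by a positive functional on `(X, X)`. -/
theorem exists_isPositiveFunctional {X Y : C} (f : HomDual X Y) :
    ∃ φ : HomDual X X, IsPositiveFunctional φ ∧ ‖φ‖ ≤ ‖f‖ ^ 2 ∧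
      ∀ c : X ⟶ Y, ‖f c‖ ^ 2 ≤ (φ (c ≫ adj c)).re := by
  obtain ⟨φ, h1, h2, h3, h4⟩ :=
    exists_positive_dominating homInner_self_nonneg norm_homInner_self f
  exact ⟨φ, ⟨h2, fun a => h3 _ (homInner_self_nonneg a)⟩, h1, h4⟩

/-- In the C*-algebra `End X` the positive element `b⋆∘b` is at most its norm `‖b‖²`. Sandwiching
the difference between `a⋆` and `a` gives `re_apply_comp_le`. -/
theorem exists_sub_comp_adj_eq {X Y : C} (b : X ⟶ Y) :
    ∃ g : X ⟶ X, ((‖b‖ ^ 2 : ℝ) : ℂ) • 𝟙 X - b ≫ adj b = g ≫ adj g := by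
  have h := IsSelfAdjoint.le_algebraMap_norm_self
    (LE.le.isSelfAdjoint (homInner_self_nonneg b))
  rw [norm_homInner_self] at h
  obtain ⟨g, hg⟩ := CStarAlgebra.nonneg_iff_eq_star_mul_self.1 (sub_nonneg.2 h)
  refine ⟨g, Eq.trans ?_ hg⟩
  rw [Algebra.algebraMap_eq_smul_one, ← Complex.coe_smul]
  rfl

namespace IsPositiveFunctional

variable {X : C} {φ : HomDual X X}

theorem re_apply_comp_le (hφ : IsPositiveFunctional φ) {Y Z : C} (a : X ⟶ Y) (b : Y ⟶ Z) :
    (φ ((a ≫ b) ≫ adj (a ≫ b))).re ≤ ‖b‖ ^ 2 * (φ (a ≫ adj a)).re := by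
  obtain ⟨g, hg⟩ := exists_sub_comp_adj_eq b
  have h := hφ.re_nonneg (a ≫ g)
  have e : (a ≫ g) ≫ adj (a ≫ g) =
      ((‖b‖ ^ 2 : ℝ) : ℂ) • (a ≫ adj a) - (a ≫ b) ≫ adj (a ≫ b) := by
    rw [adj_comp, adj_comp, Category.assoc, ← Category.assoc g, ← hg, Preadditive.sub_comp,
      Preadditive.comp_sub, Linear.smul_comp, Linear.comp_smul, Category.id_comp]
    simp only [Category.assoc]
  rw [e, map_sub, map_smul, Complex.sub_re, smul_eq_mul, Complex.re_ofReal_mul] at h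
  linarith

theorem exists_gns (hφ : IsPositiveFunctional φ) (Y : C) :
    ∃ (H : Type v) (_ : NormedAddCommGroup H) (_ : InnerProductSpace ℂ H) (_ : CompleteSpace H)
      (T : (X ⟶ Y) →L[ℂ] H), DenseRange T ∧ ∀ a b, ⟪T a, T b⟫_ℂ = φ (b ≫ adj a) := by
  refine exists_hilbert_of_posSemidef ((homInner X Y).compr₂ₛₗ (φ : (X ⟶ X) →ₗ[ℂ] ℂ))
    (fun x y => ?_) (fun x => hφ.re_nonneg x) ‖φ‖ fun x => ?_
  · change (starRingEnd ℂ) (φ (x ≫ adj y)) = φ (y ≫ adj x)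
    rw [← hφ.apply_adj, adj_comp, adj_adj]
  · refine (Complex.re_le_norm _).trans ((φ.le_opNorm _).trans ?_)
    rw [norm_homInner_self]

theorem norm_gns_sq {Y : C} {H : Type v} [NormedAddCommGroup H] [InnerProductSpace ℂ H]
    {T : (X ⟶ Y) →L[ℂ] H} (hT : ∀ a b, ⟪T a, T b⟫_ℂ = φ (b ≫ adj a)) (a : X ⟶ Y) :
    ‖T a‖ ^ 2 = (φ (a ≫ adj a)).re := by
  rw [@norm_sq_eq_re_inner ℂ, hT]; rfl

/-- On the bidual, a positive functional `φ` is nonnegative at `F⋆ ∘ F`, and if `φ` dominates `f`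
then this persists on the bidual. -/
theorem exists_apply_arensComp_bidualAdj (hφ : IsPositiveFunctional φ) {Y : C}
    (F : HomBidual X Y) :
    ∃ r : ℝ, 0 ≤ r ∧ arensComp F (bidualAdj F) φ = r ∧
      ∀ f : HomDual X Y, (∀ c, ‖f c‖ ^ 2 ≤ (φ (c ≫ adj c)).re) → ‖F f‖ ^ 2 ≤ r := by
  obtain ⟨H, _, _, _, T, hd, hT⟩ := hφ.exists_gns Y
  obtain ⟨ξ, hξ⟩ := exists_bidual_vector T F
  refine ⟨‖ξ‖ ^ 2, by positivity, ?_, fun f hf => ?_⟩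
  -- The functional `a⋆φ` is `⟨T a, T ·⟩`, so `F` takes the value `⟨T a, ξ⟩` on it.
  · have h : dualAdj (arensRight F φ) = (InnerProductSpace.toDual ℂ H ξ).comp T := by
      ext a
      have h1 : arensLeft Y φ (adj a) = (InnerProductSpace.toDual ℂ H (T a)).comp T := by
        ext c
        exact (hT a c).symm
      rw [dualAdj_apply, arensRight_apply, h1, hξ]
      exact inner_conj_symm _ _
    rw [arensComp_apply, bidualAdj_apply, h, hξ, InnerProductSpace.toDual_apply_apply,
      inner_self_eq_norm_sq_to_K]
    simp
  · obtain ⟨ℓ, hℓ, rfl⟩ := exists_dual_extension hd f zero_le_one fun a => by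
      rw [one_mul]
      refine (sq_le_sq₀ (norm_nonneg _) (norm_nonneg _)).1 ?_
      rw [norm_gns_sq hT]
      exact hf a
    rw [hξ]
    have := ℓ.le_of_opNorm_le hℓ ξ
    rw [one_mul] at this
    gcongr

end IsPositiveFunctional

/-! ### Arens regularity. -/

/-- The Arens composition is represented by functionals in its first argument. -/
theorem exists_dual_apply_arensRight {X Y Z : C} (f : HomDual X Z) (G : HomBidual Y Z) :
    ∃ g : HomDual X Y, ∀ F : HomBidual X Y, G (arensRight F f) = F g := by
  obtain ⟨φ, hφ, -, hf⟩ := exists_isPositiveFunctional f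
  obtain ⟨H, _, _, _, T, hd, hT⟩ := hφ.exists_gns Y
  refine exists_dual_forall_apply_comp_eq hd (arensLeft Y f) zero_le_one (fun b a => ?_) G
  refine (sq_le_sq₀ (norm_nonneg _) (by positivity)).1 ?_
  rw [arensLeft_apply, one_mul, mul_pow, IsPositiveFunctional.norm_gns_sq hT]
  exact (hf _).trans (hφ.re_apply_comp_le a b)

theorem arensRegular : ArensRegular C := by
  intro X Y Z
  refine ⟨fun F => WeakDual.continuous_of_continuous_eval fun f =>
    WeakDual.eval_continuous (arensRight F f), fun G =>
    WeakDual.continuous_of_continuous_eval fun f => ?_⟩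
  obtain ⟨g, hg⟩ := exists_dual_apply_arensRight f G
  exact (WeakDual.eval_continuous g).congr fun F => (hg (WeakDual.toStrongDual F)).symm

/-! ### Involution and C*-identity on the biduals. -/

theorem dualAdj_dualAdj {X Y : C} (f : HomDual X Y) : dualAdj (dualAdj f) = f := by
  ext a
  rw [dualAdj_apply, dualAdj_apply, adj_adj, Complex.conj_conj]

theorem bidualAdj_bidualAdj {X Y : C} (F : HomBidual X Y) : bidualAdj (bidualAdj F) = F := by
  ext f
  rw [bidualAdj_apply, bidualAdj_apply, dualAdj_dualAdj, Complex.conj_conj]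

theorem norm_bidualAdj_le {X Y : C} (F : HomBidual X Y) : ‖bidualAdj F‖ ≤ ‖F‖ :=
  LinearMap.mkContinuous_norm_le _ (norm_nonneg F) _

theorem bidualAdj_add {X Y : C} (F G : HomBidual X Y) :
    bidualAdj (F + G) = bidualAdj F + bidualAdj G := by
  ext f
  exact map_add (starRingEnd ℂ) _ _

theorem bidualAdj_smul {X Y : C} (c : ℂ) (F : HomBidual X Y) :
    bidualAdj (c • F) = (starRingEnd ℂ) c • bidualAdj F := by
  ext f
  exact map_mul (starRingEnd ℂ) _ _

/-- Regularity is essential: the involution exchanges the two orders of extending the composition.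
The functional `g` representing `F ↦ G(f⋆F)` is identified as `(fG⋆)⋆` by testing on canonical
images of morphisms. -/
theorem bidualAdj_arensComp {X Y Z : C} (F : HomBidual X Y) (G : HomBidual Y Z) :
    bidualAdj (arensComp F G) = arensComp (bidualAdj G) (bidualAdj F) := by
  ext f
  obtain ⟨g, hg⟩ := exists_dual_apply_arensRight (dualAdj f) G
  rw [bidualAdj_apply, arensComp_apply, hg, arensComp_apply, bidualAdj_apply]
  congr 2
  ext a
  have h1 := hg (NormedSpace.inclusionInDoubleDual ℂ (X ⟶ Y) a)
  rw [NormedSpace.dual_def] at h1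
  rw [← h1, dualAdj_apply, arensRight_apply, bidualAdj_apply, Complex.conj_conj]
  congr 1
  ext b
  rw [dualAdj_apply, arensLeft_apply, arensRight_apply, NormedSpace.dual_def, arensLeft_apply,
    dualAdj_apply, adj_comp]

theorem norm_sq_bidual {X Y : C} (F : HomBidual X Y) :
    ‖F‖ ^ 2 = ‖arensComp F (bidualAdj F)‖ := by
  have h0 : 0 ≤ ‖arensComp F (bidualAdj F)‖ := norm_nonneg (arensComp F (bidualAdj F))
  refine le_antisymm ?_ ?_
  · have h : ‖F‖ ≤ √‖arensComp F (bidualAdj F)‖ := by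
      refine ContinuousLinearMap.opNorm_le_bound _ (Real.sqrt_nonneg _) fun f => ?_
      obtain ⟨φ, hφ, hn, hf⟩ := exists_isPositiveFunctional f
      obtain ⟨r, hr, hFr, hFf⟩ := hφ.exists_apply_arensComp_bidualAdj F
      rw [← Real.sqrt_sq (norm_nonneg f), ← Real.sqrt_mul h0]
      refine Real.le_sqrt_of_sq_le ((hFf f hf).trans ?_)
      have h1 := (arensComp F (bidualAdj F)).le_opNorm φ
      rw [hFr, Complex.norm_real, Real.norm_of_nonneg hr] at h1
      exact h1.trans (by gcongr)
    calc ‖F‖ ^ 2 ≤ √‖arensComp F (bidualAdj F)‖ ^ 2 := by gcongr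
      _ = _ := Real.sq_sqrt h0
  · refine (norm_arensComp_le _ _).trans ?_
    rw [sq]
    gcongr
    exact norm_bidualAdj_le F

/-- If `F⋆ ∘ F = - K⋆ ∘ K` in the Arens bidual then `K = 0`. -/
theorem eq_zero_of_arensComp_bidualAdj_eq_neg {X Y Z : C} {F : HomBidual X Y} {K : HomBidual X Z}
    (h : arensComp F (bidualAdj F) = -arensComp K (bidualAdj K)) : K = 0 := by
  ext f
  obtain ⟨φ, hφ, -, hf⟩ := exists_isPositiveFunctional f
  obtain ⟨r, hr, hFr, -⟩ := hφ.exists_apply_arensComp_bidualAdj F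
  obtain ⟨r', -, hKr, hKf⟩ := hφ.exists_apply_arensComp_bidualAdj K
  have h1 : (r : ℂ) = -(r' : ℂ) := by
    rw [← hFr, ← hKr, h]; rfl
  have h2 : r = -r' := by exact_mod_cast h1
  have h3 := hKf f hf
  have h4 : ‖K f‖ = 0 := by nlinarith [norm_nonneg (K f)]
  simpa using h4

/-! ### The C*-category structure on the Arens bidual. -/

namespace ArensBidual

theorem adj_comp {X Y Z : ArensBidual C} (F : X ⟶ Y) (G : Y ⟶ Z) :
    adj (F ≫ G) = adj G ≫ adj F :=
  bidualAdj_arensComp (X := X.obj) (Y := Y.obj) (Z := Z.obj) F G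

theorem adj_adj {X Y : ArensBidual C} (F : X ⟶ Y) : adj (adj F) = F :=
  bidualAdj_bidualAdj (X := X.obj) (Y := Y.obj) F

theorem complete (X Y : ArensBidual C) : CompleteSpace (X ⟶ Y) :=
  inferInstanceAs (CompleteSpace (HomBidual X.obj Y.obj))

/-- The endomorphisms of an object of the Arens bidual form a C*-algebra. -/
noncomputable instance (X : ArensBidual C) : CStarAlgebra (End X) :=
  endCStarAlgebra X (complete X X) adj adj_adj bidualAdj_add bidualAdj_smul adj_comp
    norm_sq_bidual

theorem exists_adj_comp_self {X Y : ArensBidual C} (F : X ⟶ Y) :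
    ∃ g : X ⟶ X, F ≫ adj F = g ≫ adj g := by
  have hh : IsSelfAdjoint (End.of (F ≫ adj F)) := by
    change adj (F ≫ adj F) = F ≫ adj F
    rw [adj_comp, adj_adj]
  obtain ⟨p, n, s, hn, hp, hnhn, h0⟩ := hh.exists_jordan
  -- Here `(F∘n)⋆∘(F∘n) = n (F⋆∘F) n = -(s n)⋆ (s n)`, so the negative part vanishes and `F⋆∘F =
  -- p⋆p`.
  have hK : s * n = 0 := by
    refine eq_zero_of_arensComp_bidualAdj_eq_neg (F := (n ≫ F : X ⟶ Y)) (X := X.obj)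
      (Z := X.obj) (Eq.trans ?_ hnhn)
    change (n ≫ F) ≫ adj (n ≫ F) = n ≫ (F ≫ adj F) ≫ n
    rw [adj_comp, Category.assoc, Category.assoc]
    exact congrArg (fun m => n ≫ F ≫ adj F ≫ m) hn
  rw [h0 hK, sub_zero] at hp
  exact ⟨p, hp⟩

/-- The Arens bidual of a C*-category is a C*-category. -/
@[reducible]
noncomputable def cstarCategory : CStarCategory (ArensBidual C) where
  __ := toNormedLinearCategory
  complete := complete
  adj := adj
  adj_add {X Y} F G := bidualAdj_add (X := X.obj) (Y := Y.obj) F G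
  adj_smul {X Y} c F := bidualAdj_smul (X := X.obj) (Y := Y.obj) c F
  adj_adj := adj_adj
  adj_comp := adj_comp
  norm_sq_eq {X Y} F := norm_sq_bidual (X := X.obj) (Y := Y.obj) F
  exists_adj_comp_self := exists_adj_comp_self

end ArensBidual

end PositiveFunctionals

theorem mainTheorem11 (C : Type u) [Category.{v} C] [CStarCategory C] :
    ArensRegular C ∧
    ∃ S : CStarCategory (ArensBidual C),
      S.toNormedLinearCategory = ArensBidual.toNormedLinearCategory ∧
      ∀ (X Y : ArensBidual C) (F : X ⟶ Y), S.adj F = ArensBidual.adj F :=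
  ⟨arensRegular, ArensBidual.cstarCategory, rfl, fun _ _ _ => rfl⟩
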